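/- Fix a logarithm base $b>1$ (write $\log=\log_b$, $e=\exp(1)$) and $\rho\in(-1,1)$. Let $(X,Y)$ be centered bivariate Gaussian with unit variances and correlation $\rho$, and let $T_{(n)}=g_n(X,Y)$, $n=1,2,\dots$, with continuous kernels $g_n:\mathbb R^2\to\mathbb R$. For a target $T$ write $p_X,p_T,p_{X,T},p_{X|T}=p_{X,T}/p_T$ for the (joint, conditional) Lebesgue densities, and similarly with $Y$ in place of $X$. Let $$I_X(t)=\mathbb E\Big[\log\tfrac{p_{X,T}(X,T)}{p_X(X)\,p_T(T)}\,\Big|\,T=t\Big]\in[0,\infty]$$ be the specific information. The MIN unique information is $$U_X^{\min}(T;X,Y)=\mathbb E\big[I_X(T)-\min(I_X(T),I_Y(T))\big]\in[0,\infty],$$ so that $I(T;X)=\mathbb E\min(I_X(T),I_Y(T))+U_X^{\min}$. With the specificity $h_X^+=\log\frac1{p_X(X)}$ and the ambiguity $h_X^-=\log\frac1{p_{X|T}(X|T)}$, put $$(U_X^{PM})^{\pm}=\mathbb E\big[h_X^{\pm}-\min(h_X^{\pm},h_Y^{\pm})\big]\in[0,\infty],\qquad U_X^{PM}=(U_X^{PM})^+-(U_X^{PM})^-.$$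 The quantities with index $Y$ are obtained by exchanging $X$ and $Y$. Assume that there is an open set $U\subset\mathbb R^2$ with $P((X,Y)\in U)=1$ such that, for every $n$, $g_n$ is $C^1$ on $U$, $|\partial_x g_n|>0$ and $|\partial_y g_n|>0$ on $U$, and the sections $g_n(x,\cdot)$ and $g_n(\cdot,y)$ are injective on the corresponding sections of $U$. Assume that for every $n$, $\min(I_X(T_{(n)}),I_Y(T_{(n)}))<\infty$ almost surely (so that the differences of specific informations are defined), and that $U_X^{\min},U_Y^{\min},U_X^{PM},U_Y^{PM}$ are all finite for $T_{(1)}$. If, almost surely, $$\frac{|\partial_x g_n|}{|\partial_y g_n|}(X,Y)\ \downarrow\ 0\quad(n\to\infty),$$ then, as $n\to\infty$, $$U_X^{\min}(T_{(n)};X,Y)\to0,\qquad U_X^{PM}(T_{(n)};X,Y)\to-\infty,\qquad (U_X^{PM})^-(T_{(n)};X,Y)\to\infty,$$ $$U_Y^{\min}(T_{(n)};X,Y)\to\infty,\qquad U_Y^{PM}(T_{(n)};X,Y)\to c(\rho),\qquad (U_Y^{PM})^-(T_{(n)};X,Y)\to0,$$ where $c(\rho)=\frac{\log e}{\pi}\sqrt{1-\rho^2}$.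 -/

import Mathlib

open MeasureTheory Filter Topology
open scoped ENNReal

noncomputable section

namespace NFBI

/-- The centered bivariate normal law with unit variances and correlation `ρ` (for `|ρ| < 1`),
given by its Lebesgue density. -/
def stdBivariateNormal (ρ : ℝ) : Measure (ℝ × ℝ) :=
  volume.withDensity fun z =>
    ENNReal.ofReal (1 / (2 * Real.pi * Real.sqrt (1 - ρ ^ 2)) *
      Real.exp (-(z.1 ^ 2 - 2 * ρ * z.1 * z.2 + z.2 ^ 2) / (2 * (1 - ρ ^ 2))))

variable {Ω : Type*} [MeasurableSpace Ω]

/-- `X, Y →_ρ T` : a normalized Gaussian noise-free bivariate interaction with kernel `g`. -/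
structure IsNormalizedGaussian (μ : Measure Ω) (ρ : ℝ) (X Y T : Ω → ℝ) (g : ℝ × ℝ → ℝ) :
    Prop where
  measurable_fst : Measurable X
  measurable_snd : Measurable Y
  law : μ.map (fun ω => (X ω, Y ω)) = stdBivariateNormal ρ
  continuous_kernel : Continuous g
  target_eq : ∀ ω, T ω = g (X ω, Y ω)

/-- `∂ₓ g` -/
def partialX (g : ℝ × ℝ → ℝ) (z : ℝ × ℝ) : ℝ := deriv (fun s => g (s, z.2)) z.1

/-- `∂_y g` -/
def partialY (g : ℝ × ℝ → ℝ) (z : ℝ × ℝ) : ℝ := deriv (fun s => g (z.1, s)) z.2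

/-- The kernel `g` is well-behaved on `U`, where `U` is an open set of full measure for `(X, Y)`:
`g` is continuously differentiable on `U`, both partials are nonzero on `U`, and the sections of
`g` are invertible on the sections of `U`, so that the inverses `(g(x, ·))⁻¹(t)` and
`(g(·, y))⁻¹(t)` make sense. -/
structure WellBehavedOn (μ : Measure Ω) (X Y : Ω → ℝ) (g : ℝ × ℝ → ℝ) (U : Set (ℝ × ℝ)) :
    Prop where
  isOpen : IsOpen U
  full : μ.map (fun ω => (X ω, Y ω)) U = 1
  contDiffOn : ContDiffOn ℝ 1 g U
  partialX_pos : ∀ z ∈ U, 0 < |partialX g z|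
  partialY_pos : ∀ z ∈ U, 0 < |partialY g z|
  injOn_snd : ∀ x : ℝ, Set.InjOn (fun y => g (x, y)) {y | (x, y) ∈ U}
  injOn_fst : ∀ y : ℝ, Set.InjOn (fun x => g (x, y)) {x | (x, y) ∈ U}

/-- Lebesgue density `p_X` of a real random variable. -/
def dens (μ : Measure Ω) (X : Ω → ℝ) (x : ℝ) : ℝ := (pdf X μ volume x).toReal

/-- Lebesgue density `p_{X,T}` of a pair of real random variables. -/
def jointDens (μ : Measure Ω) (X T : Ω → ℝ) (x t : ℝ) : ℝ :=
  (pdf (fun ω => (X ω, T ω)) μ volume (x, t)).toReal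

/-- Conditional density `p_{X|T}(x|t) = p_{X,T}(x,t) / p_T(t)`. -/
def condDens (μ : Measure Ω) (X T : Ω → ℝ) (x t : ℝ) : ℝ := jointDens μ X T x t / dens μ T t

/-- Pointwise mutual information `log (p_{X,T}(x,t) / (p_X(x) p_T(t)))`, logarithm to base `b`. -/
def pointwiseInfo (b : ℝ) (μ : Measure Ω) (X T : Ω → ℝ) (x t : ℝ) : ℝ :=
  Real.logb b (jointDens μ X T x t / (dens μ X x * dens μ T t))

/-- Specific information
`I_X(t) = E[log (p_{X,T}(X,T) / (p_X(X) p_T(T))) | T = t]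
        = ∫ p_{X|T}(x|t) log (p_{X,T}(x,t) / (p_X(x) p_T(t))) dx`,
a relative entropy with values in `[0, ∞]`. It is written as (integral of the positive part) minus
(integral of the negative part). The latter is at most `1 / log b`, and at most the former for
almost every outcome `t` (Gibbs' inequality), so the subtraction in `[0, ∞]` is the usual one. -/
def specificInfo (b : ℝ) (μ : Measure Ω) (X T : Ω → ℝ) (t : ℝ) : ℝ≥0∞ :=
  (∫⁻ x, ENNReal.ofReal (condDens μ X T x t) * ENNReal.ofReal (pointwiseInfo b μ X T x t)) -
    ∫⁻ x, ENNReal.ofReal (condDens μ X T x t) * ENNReal.ofReal (-pointwiseInfo b μ X T x t)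

/-- Mutual information `I(T; X) = E[I_X(T)]`. -/
def mutualInfo (b : ℝ) (μ : Measure Ω) (X T : Ω → ℝ) : ℝ≥0∞ :=
  ∫⁻ ω, specificInfo b μ X T (T ω) ∂μ

/-- Redundant information `I_∩^MIN(T; X, Y) = E[min (I_X(T), I_Y(T))]`. -/
def redundancyMin (b : ℝ) (μ : Measure Ω) (X Y T : Ω → ℝ) : ℝ≥0∞ :=
  ∫⁻ ω, min (specificInfo b μ X T (T ω)) (specificInfo b μ Y T (T ω)) ∂μ

/-- Unique information `U_X^MIN(T; X, Y) = E[I_X(T) - min (I_X(T), I_Y(T))]`, which is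
`I(T; X) - I_∩^MIN(T; X, Y)` (see `mutualInfo_eq_redundancy_add_unique`). `U_Y^MIN` is obtained by
exchanging `X` and `Y`. -/
def uniqueMin (b : ℝ) (μ : Measure Ω) (X Y T : Ω → ℝ) : ℝ≥0∞ :=
  ∫⁻ ω, (specificInfo b μ X T (T ω) -
    min (specificInfo b μ X T (T ω)) (specificInfo b μ Y T (T ω))) ∂μ

/-- Pointwise specificity `log (1 / p_X(X))`. -/
def specificity (b : ℝ) (μ : Measure Ω) (X : Ω → ℝ) (ω : Ω) : ℝ :=
  Real.logb b (1 / dens μ X (X ω))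

/-- Pointwise ambiguity `log (1 / p_{X|T}(X|T))`. -/
def ambiguity (b : ℝ) (μ : Measure Ω) (X T : Ω → ℝ) (ω : Ω) : ℝ :=
  Real.logb b (1 / condDens μ X T (X ω) (T ω))

/-- Unique specificity `(U_X^PM)⁺`: the expectation of the specificity of `X` minus the redundant
specificity (the minimum of the specificities of `X` and `Y`). -/
def uniquePMSpecificity (b : ℝ) (μ : Measure Ω) (X Y : Ω → ℝ) : ℝ≥0∞ :=
  ∫⁻ ω, ENNReal.ofReal
    (specificity b μ X ω - min (specificity b μ X ω) (specificity b μ Y ω)) ∂μ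

/-- Unique ambiguity `(U_X^PM)⁻`: the expectation of the ambiguity of `X` minus the redundant
ambiguity (the minimum of the ambiguities of `X` and `Y`). -/
def uniquePMAmbiguity (b : ℝ) (μ : Measure Ω) (X Y T : Ω → ℝ) : ℝ≥0∞ :=
  ∫⁻ ω, ENNReal.ofReal
    (ambiguity b μ X T ω - min (ambiguity b μ X T ω) (ambiguity b μ Y T ω)) ∂μ

/-- Unique information `U_X^PM = (U_X^PM)⁺ - (U_X^PM)⁻`, in the extended reals. -/
def uniquePM (b : ℝ) (μ : Measure Ω) (X Y T : Ω → ℝ) : EReal :=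
  (uniquePMSpecificity b μ X Y : EReal) - (uniquePMAmbiguity b μ X Y T : EReal)

theorem measurable_specificInfo (b : ℝ) (μ : Measure Ω) (X T : Ω → ℝ) :
    Measurable (specificInfo b μ X T) := by
  have h1 : Measurable (fun z : ℝ × ℝ => jointDens μ X T z.1 z.2) :=
    (measurable_pdf _ μ volume).ennreal_toReal
  have h2 : Measurable (dens μ T) := (measurable_pdf _ μ volume).ennreal_toReal
  have h3 : Measurable (dens μ X) := (measurable_pdf _ μ volume).ennreal_toReal
  have hc : Measurable (fun z : ℝ × ℝ => condDens μ X T z.1 z.2) :=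
    h1.div (h2.comp measurable_snd)
  have hp : Measurable (fun z : ℝ × ℝ => pointwiseInfo b μ X T z.1 z.2) :=
    (Real.measurable_log.comp
      (h1.div ((h3.comp measurable_fst).mul (h2.comp measurable_snd)))).div_const _
  exact (Measurable.lintegral_prod_left' (μ := (volume : Measure ℝ))
      (hc.ennreal_ofReal.mul hp.ennreal_ofReal)).sub
    (Measurable.lintegral_prod_left' (μ := (volume : Measure ℝ))
      (hc.ennreal_ofReal.mul hp.neg.ennreal_ofReal))

/-- The defining equation `I(T; X) = I_∩^MIN(T; X, Y) + U_X^MIN(T; X, Y)`. -/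
theorem mutualInfo_eq_redundancy_add_unique (b : ℝ) (μ : Measure Ω) (X Y T : Ω → ℝ)
    (hT : Measurable T) :
    mutualInfo b μ X T = redundancyMin b μ X Y T + uniqueMin b μ X Y T := by
  unfold mutualInfo redundancyMin uniqueMin
  rw [← lintegral_add_left]
  · exact lintegral_congr fun ω => (add_tsub_cancel_of_le (min_le_left _ _)).symm
  · exact ((measurable_specificInfo b μ X T).comp hT).min
      ((measurable_specificInfo b μ Y T).comp hT)

end NFBI

end

/-!
Write `r = |∂ₓ g| / |∂_y g|` at `(X, Y)` and `L = log r`. The coordinate change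
`(x, y) ↦ (x, g (x, y))` has Jacobian `∂_y g`, so `p_{X,T} (X, T) = p_{X,Y} (X, Y) / |∂_y g|`, and
likewise `p_{Y,T} (Y, T) = p_{X,Y} (X, Y) / |∂ₓ g|` (`exists_jointDensity`, `ae_jointDens_eq`). Hence
almost surely, with `D = (X² - Y²) / 2 · log e`,

* the ambiguities satisfy `h_X⁻ - h_Y⁻ = -L` (`ae_ambiguity_sub`),
* the specificities satisfy `h_X⁺ - h_Y⁺ = D` (`ae_specificity_sub`),
* the pointwise informations satisfy `i_X - i_Y = L + D` (`ae_pointwiseInfo_sub`).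

For the pointwise atoms this gives `(U_X^PM)⁻ = E[L⁻]` and `(U_Y^PM)⁻ = E[L⁺]`. As `L` decreases to
`-∞` along the sequence, the former tends to `∞` by monotone convergence and the latter to `0` by
dominated convergence, the first term being finite by assumption. Both specificity parts equal
`E[D⁺] = c(ρ)`: by exchangeability this is `E|X² - Y²| / 4 · log e`, and
`E|X² - Y²| = E|X - Y| E|X + Y|` by independence (`lintegral_sq_sub_sq`).

For the MIN atoms, `I_X(T) - I_Y(T)` is formally the conditional expectation of `L + D` given `T`.
Conditioning the balance of positive and negative parts instead (`ae_specificInfo_balance`), and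
using that the negative parts of the specific informations are at most `log e`
(`lintegral_condDens_mul_neg_pointwiseInfo_le`), gives `U_X^MIN ≤ E[(L + D)⁺]`
(`uniqueMin_le_lintegral`) and `E[(L + D)⁻] ≤ U_Y^MIN + log e + E[(L + D)⁺]`
(`lintegral_le_uniqueMin_add`, with the roles of `X` and `Y` exchanged). Here `E[(L + D)⁺] → 0` and
`E[(L + D)⁻] → ∞`, again by dominated and monotone convergence.
-/

noncomputable section

namespace NFBI

variable {Ω : Type*} [MeasurableSpace Ω]

/-! ### Preliminary integrals -/

theorem _root_.MeasureTheory.lintegral_comp_add_mul {h : ℝ → ℝ≥0∞} (hh : Measurable h) (u : ℝ)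
    {a : ℝ} (ha : 0 < a) : ∫⁻ y, h (u + a * y) = ENNReal.ofReal a⁻¹ * ∫⁻ v, h v := by
  have h1 : Measurable fun z => h (u + z) := hh.comp (measurable_const_add u)
  have key : ∫⁻ y, h (u + a * y) = ∫⁻ z, h (u + z) ∂(volume.map (a * ·)) :=
    (lintegral_map h1 (measurable_const_mul a)).symm
  rw [key, Real.map_volume_mul_left ha.ne', lintegral_smul_measure,
    lintegral_add_left_eq_self h u, abs_of_pos (inv_pos.2 ha), smul_eq_mul]

/-- Integration in the coordinates `u = x - y`, `v = x + y`. -/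
theorem _root_.MeasureTheory.lintegral_comp_sub_add {F : ℝ × ℝ → ℝ≥0∞} (hF : Measurable F) :
    ∫⁻ z : ℝ × ℝ, F (z.1 - z.2, z.1 + z.2) = ENNReal.ofReal 2⁻¹ * ∫⁻ u, ∫⁻ v, F (u, v) := by
  have m1 : Measurable fun z : ℝ × ℝ => F (z.1 - z.2, z.1 + z.2) := by fun_prop
  have m2 : Measurable fun z : ℝ × ℝ => F (z.2, z.2 + 2 * z.1) := by fun_prop
  rw [Measure.volume_eq_prod, lintegral_prod_symm _ m1.aemeasurable]
  calc ∫⁻ y, ∫⁻ x, F (x - y, x + y)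
      = ∫⁻ y, ∫⁻ u, F (u, u + 2 * y) := by
        refine lintegral_congr fun y => ?_
        rw [← lintegral_sub_right_eq_self (fun u => F (u, u + 2 * y)) y]
        refine lintegral_congr fun x => ?_
        congr 2
        ring
    _ = ∫⁻ u, ∫⁻ y, F (u, u + 2 * y) := lintegral_lintegral_swap m2.aemeasurable
    _ = ∫⁻ u, ENNReal.ofReal 2⁻¹ * ∫⁻ v, F (u, v) := by
        refine lintegral_congr fun u => ?_
        exact lintegral_comp_add_mul (hF.comp measurable_prodMk_left) u two_pos
    _ = _ := lintegral_const_mul _ hF.lintegral_prod_right'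

theorem lintegral_abs_mul_exp_neg_mul_sq {a : ℝ} (ha : 0 < a) :
    ∫⁻ u, ENNReal.ofReal (|u| * Real.exp (-a * u ^ 2)) = ENNReal.ofReal a⁻¹ := by
  have hint : Integrable fun u : ℝ => |u| * Real.exp (-a * u ^ 2) := by
    refine (integrable_mul_exp_neg_mul_sq ha).norm.congr (Eventually.of_forall fun u => ?_)
    simp
  rw [← ofReal_integral_eq_lintegral_ofReal hint (Eventually.of_forall fun u => by positivity)]
  congr 1
  have h1 := integral_comp_abs (f := fun u : ℝ => u * Real.exp (-a * u ^ 2))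
  simp only [sq_abs] at h1
  have h2 := integral_rpow_mul_exp_neg_mul_rpow (p := 2) (q := 1) two_pos (by norm_num) ha
  have h3 : ∫ x in Set.Ioi (0 : ℝ), x * Real.exp (-a * x ^ 2) = a⁻¹ / 2 := by
    rw [show a⁻¹ / 2 = a ^ (-((1 : ℝ) + 1) / 2) * (1 / 2) * Real.Gamma ((1 + 1) / 2) by
      norm_num [Real.rpow_neg_one]; ring, ← h2]
    refine setIntegral_congr_fun measurableSet_Ioi fun x _ => ?_
    simp
  rw [h1, h3]
  ring

/-! ### The standard bivariate normal law -/

/-- The Lebesgue density of `stdBivariateNormal`. -/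
def bivariateDensity (ρ : ℝ) (z : ℝ × ℝ) : ℝ :=
  1 / (2 * Real.pi * Real.sqrt (1 - ρ ^ 2)) *
    Real.exp (-(z.1 ^ 2 - 2 * ρ * z.1 * z.2 + z.2 ^ 2) / (2 * (1 - ρ ^ 2)))

theorem stdBivariateNormal_eq (ρ : ℝ) : stdBivariateNormal ρ =
    volume.withDensity fun z => ENNReal.ofReal (bivariateDensity ρ z) := rfl

theorem measurable_bivariateDensity (ρ : ℝ) : Measurable (bivariateDensity ρ) := by
  unfold bivariateDensity
  fun_prop

theorem bivariateDensity_swap (ρ : ℝ) (z : ℝ × ℝ) :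
    bivariateDensity ρ z.swap = bivariateDensity ρ z := by
  simp only [bivariateDensity, Prod.fst_swap, Prod.snd_swap]
  congr 3
  ring

theorem one_sub_sq_pos {ρ : ℝ} (hρ : |ρ| < 1) : 0 < 1 - ρ ^ 2 := by
  have := (sq_lt_one_iff_abs_lt_one ρ).2 hρ
  linarith

theorem bivariateDensity_pos {ρ : ℝ} (hρ : |ρ| < 1) (z : ℝ × ℝ) : 0 < bivariateDensity ρ z := by
  have := Real.sqrt_pos.2 (one_sub_sq_pos hρ)
  have := Real.pi_pos
  unfold bivariateDensity
  positivity

theorem map_swap_stdBivariateNormal (ρ : ℝ) :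
    (stdBivariateNormal ρ).map Prod.swap = stdBivariateNormal ρ := by
  ext S hS
  rw [Measure.map_apply measurable_swap hS, stdBivariateNormal_eq,
    withDensity_apply _ (measurable_swap hS), withDensity_apply _ hS]
  have h : MeasurePreserving (Prod.swap : ℝ × ℝ → ℝ × ℝ) volume volume :=
    Measure.measurePreserving_swap
  rw [← h.setLIntegral_comp_preimage hS (measurable_bivariateDensity ρ).ennreal_ofReal]
  simp only [bivariateDensity_swap]

/-- Factorization of the bivariate density into the marginal of `X` and the conditional law of `Y`
given `X = x`, which is Gaussian with mean `ρ x` and variance `1 - ρ²`. -/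
theorem bivariateDensity_eq_mul {ρ : ℝ} (hρ : |ρ| < 1) (x y : ℝ) :
    bivariateDensity ρ (x, y) = ProbabilityTheory.gaussianPDFReal 0 1 x *
      ProbabilityTheory.gaussianPDFReal (ρ * x) (Real.toNNReal (1 - ρ ^ 2)) y := by
  have h := one_sub_sq_pos hρ
  have hpi := Real.pi_pos
  simp only [bivariateDensity, ProbabilityTheory.gaussianPDFReal, Real.coe_toNNReal _ h.le,
    NNReal.coe_one]
  rw [mul_mul_mul_comm, ← Real.exp_add, ← mul_inv, one_div]
  congr 2
  · rw [← Real.sqrt_mul (by positivity),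
      show 2 * Real.pi * 1 * (2 * Real.pi * (1 - ρ ^ 2)) = (2 * Real.pi) ^ 2 * (1 - ρ ^ 2) by ring,
      Real.sqrt_mul (by positivity), Real.sqrt_sq (by positivity)]
  · field_simp
    ring

theorem map_fst_stdBivariateNormal {ρ : ℝ} (hρ : |ρ| < 1) :
    (stdBivariateNormal ρ).map Prod.fst =
      volume.withDensity (ProbabilityTheory.gaussianPDF 0 1) := by
  have hv : Real.toNNReal (1 - ρ ^ 2) ≠ 0 := (Real.toNNReal_pos.2 (one_sub_sq_pos hρ)).ne'
  ext S hS
  rw [Measure.map_apply measurable_fst hS, stdBivariateNormal_eq,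
    withDensity_apply _ (measurable_fst hS), withDensity_apply _ hS,
    show (Prod.fst ⁻¹' S : Set (ℝ × ℝ)) = S ×ˢ Set.univ by ext; simp,
    Measure.volume_eq_prod, setLIntegral_prod _
      (measurable_bivariateDensity ρ).ennreal_ofReal.aemeasurable]
  refine lintegral_congr fun x => ?_
  simp only [bivariateDensity_eq_mul hρ,
    ENNReal.ofReal_mul (ProbabilityTheory.gaussianPDFReal_nonneg 0 1 x), setLIntegral_univ]
  rw [lintegral_const_mul _ (ProbabilityTheory.measurable_gaussianPDFReal _ _).ennreal_ofReal,
    ProbabilityTheory.lintegral_gaussianPDFReal_eq_one _ hv, mul_one]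
  rfl

/-- The change of variables `u = x - y`, `v = x + y` decouples the bivariate Gaussian, which gives
`E|X² - Y²| = E|X - Y| E|X + Y|`. -/
theorem lintegral_abs_sq_sub_sq {ρ : ℝ} (hρ : |ρ| < 1) :
    ∫⁻ z, ENNReal.ofReal |z.1 ^ 2 - z.2 ^ 2| ∂(stdBivariateNormal ρ) =
      ENNReal.ofReal (4 * Real.sqrt (1 - ρ ^ 2) / Real.pi) := by
  have h := one_sub_sq_pos hρ
  have hpi := Real.pi_pos
  have h1 : 0 < 1 - ρ := by linarith [(abs_lt.1 hρ).2]
  have h2 : 0 < 1 + ρ := by linarith [(abs_lt.1 hρ).1]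
  have hs := Real.sqrt_pos.2 h
  set K : ℝ := 1 / (2 * Real.pi * Real.sqrt (1 - ρ ^ 2)) with hK
  have hK0 : 0 ≤ K := by positivity
  set F : ℝ × ℝ → ℝ≥0∞ := fun w =>
    ENNReal.ofReal (K * (|w.1| * Real.exp (-(4 * (1 - ρ))⁻¹ * w.1 ^ 2))) *
      ENNReal.ofReal (|w.2| * Real.exp (-(4 * (1 + ρ))⁻¹ * w.2 ^ 2)) with hF
  have hFm : Measurable F := by
    rw [hF]
    fun_prop
  rw [stdBivariateNormal_eq, lintegral_withDensity_eq_lintegral_mul _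
    (measurable_bivariateDensity ρ).ennreal_ofReal (by fun_prop)]
  have hpt : ∀ z : ℝ × ℝ, ((fun z : ℝ × ℝ => ENNReal.ofReal (bivariateDensity ρ z)) *
      fun z : ℝ × ℝ => ENNReal.ofReal |z.1 ^ 2 - z.2 ^ 2|) z = F (z.1 - z.2, z.1 + z.2) := by
    intro z
    simp only [Pi.mul_apply, hF]
    rw [← ENNReal.ofReal_mul (bivariateDensity_pos hρ z).le, ← ENNReal.ofReal_mul (by positivity)]
    congr 1
    have e1 : |z.1 ^ 2 - z.2 ^ 2| = |z.1 - z.2| * |z.1 + z.2| := by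
      rw [← abs_mul]
      ring_nf
    have e2 : Real.exp (-(z.1 ^ 2 - 2 * ρ * z.1 * z.2 + z.2 ^ 2) / (2 * (1 - ρ ^ 2))) =
        Real.exp (-(4 * (1 - ρ))⁻¹ * (z.1 - z.2) ^ 2) *
          Real.exp (-(4 * (1 + ρ))⁻¹ * (z.1 + z.2) ^ 2) := by
      rw [← Real.exp_add, show 1 - ρ ^ 2 = (1 - ρ) * (1 + ρ) by ring]
      congr 1
      field_simp
      ring
    rw [bivariateDensity, e1, e2]
    ring
  rw [lintegral_congr hpt, lintegral_comp_sub_add hFm]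
  have hin : ∀ u, ∫⁻ v, F (u, v) =
      ENNReal.ofReal (K * (|u| * Real.exp (-(4 * (1 - ρ))⁻¹ * u ^ 2))) *
        ENNReal.ofReal (4 * (1 + ρ)) := by
    intro u
    simp only [hF]
    rw [lintegral_const_mul _ (by fun_prop), lintegral_abs_mul_exp_neg_mul_sq (by positivity),
      inv_inv]
  simp only [hin, ENNReal.ofReal_mul hK0]
  rw [lintegral_mul_const _ (by fun_prop), lintegral_const_mul _ (by fun_prop),
    lintegral_abs_mul_exp_neg_mul_sq (by positivity), inv_inv, ← ENNReal.ofReal_mul hK0,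
    ← ENNReal.ofReal_mul (by positivity), ← ENNReal.ofReal_mul (by positivity)]
  congr 1
  have hsq := Real.sq_sqrt h.le
  rw [hK]
  field_simp
  nlinarith [hsq]

/-- By exchangeability, the positive part of `X² - Y²` carries half of `E|X² - Y²|`. -/
theorem lintegral_sq_sub_sq {ρ : ℝ} (hρ : |ρ| < 1) :
    ∫⁻ z, ENNReal.ofReal (z.1 ^ 2 - z.2 ^ 2) ∂(stdBivariateNormal ρ) =
      ENNReal.ofReal (2 * Real.sqrt (1 - ρ ^ 2) / Real.pi) := by
  set J := ∫⁻ z, ENNReal.ofReal (z.1 ^ 2 - z.2 ^ 2) ∂(stdBivariateNormal ρ) with hJ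
  have hswap : ∫⁻ z, ENNReal.ofReal (z.2 ^ 2 - z.1 ^ 2) ∂(stdBivariateNormal ρ) = J := by
    rw [hJ]
    nth_rw 2 [← map_swap_stdBivariateNormal ρ]
    rw [lintegral_map (by fun_prop) measurable_swap]
    rfl
  have hsum : J + J = ENNReal.ofReal (4 * Real.sqrt (1 - ρ ^ 2) / Real.pi) := by
    nth_rw 2 [← hswap]
    rw [hJ, ← lintegral_add_left (by fun_prop), ← lintegral_abs_sq_sub_sq hρ]
    refine lintegral_congr fun z => ?_
    rcases le_total (z.1 ^ 2) (z.2 ^ 2) with h | h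
    · rw [ENNReal.ofReal_of_nonpos (by linarith), zero_add, abs_of_nonpos (by linarith), neg_sub]
    · rw [ENNReal.ofReal_of_nonpos (p := z.2 ^ 2 - z.1 ^ 2) (by linarith), add_zero,
        abs_of_nonneg (by linarith)]
  have hpi := Real.pi_pos
  have h2 : (2 : ℝ≥0∞) * J = 2 * ENNReal.ofReal (2 * Real.sqrt (1 - ρ ^ 2) / Real.pi) := by
    rw [two_mul, hsum, ← ENNReal.ofReal_ofNat, ← ENNReal.ofReal_mul two_pos.le]
    congr 1
    ring
  exact (ENNReal.mul_right_inj two_ne_zero ENNReal.ofNat_ne_top).1 h2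

/-! ### Exchanging the two inputs -/

theorem IsNormalizedGaussian.swap {μ : Measure Ω} {ρ : ℝ} {X Y T : Ω → ℝ} {g : ℝ × ℝ → ℝ}
    (h : IsNormalizedGaussian μ ρ X Y T g) : IsNormalizedGaussian μ ρ Y X T (g ∘ Prod.swap) where
  measurable_fst := h.measurable_snd
  measurable_snd := h.measurable_fst
  law := by
    rw [← map_swap_stdBivariateNormal, ← h.law,
      Measure.map_map measurable_swap (h.measurable_fst.prodMk h.measurable_snd)]
    rfl
  continuous_kernel := h.continuous_kernel.comp continuous_swap
  target_eq := h.target_eq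

theorem WellBehavedOn.swap {μ : Measure Ω} {X Y : Ω → ℝ} {g : ℝ × ℝ → ℝ} {U : Set (ℝ × ℝ)}
    (hX : Measurable X) (hY : Measurable Y) (h : WellBehavedOn μ X Y g U) :
    WellBehavedOn μ Y X (g ∘ Prod.swap) (Prod.swap ⁻¹' U) where
  isOpen := h.isOpen.preimage continuous_swap
  full := by
    rw [Measure.map_apply (hY.prodMk hX) (h.isOpen.preimage continuous_swap).measurableSet,
      ← h.full, Measure.map_apply (hX.prodMk hY) h.isOpen.measurableSet]
    rfl
  contDiffOn := h.contDiffOn.comp (contDiff_snd.prodMk contDiff_fst).contDiffOn fun _ hz => hz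
  partialX_pos := fun z hz => h.partialY_pos z.swap hz
  partialY_pos := fun z hz => h.partialX_pos z.swap hz
  injOn_snd := h.injOn_fst
  injOn_fst := h.injOn_snd

/-! ### Densities of the target and of the pairs -/

theorem measurable_partialY {g : ℝ × ℝ → ℝ} (hg : Continuous g) : Measurable (partialY g) :=
  measurable_deriv_with_param (f := fun x y => g (x, y)) hg

theorem measurable_partialX {g : ℝ × ℝ → ℝ} (hg : Continuous g) : Measurable (partialX g) :=
  (measurable_partialY (hg.comp continuous_swap)).comp measurable_swap

theorem IsNormalizedGaussian.measurable_target {μ : Measure Ω} {ρ : ℝ} {X Y T : Ω → ℝ}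
    {g : ℝ × ℝ → ℝ} (h : IsNormalizedGaussian μ ρ X Y T g) : Measurable T := by
  rw [funext h.target_eq]
  exact h.continuous_kernel.measurable.comp (h.measurable_fst.prodMk h.measurable_snd)

theorem WellBehavedOn.ae_mem {μ : Measure Ω} [IsProbabilityMeasure μ] {X Y : Ω → ℝ}
    {g : ℝ × ℝ → ℝ} {U : Set (ℝ × ℝ)} (hX : Measurable X) (hY : Measurable Y)
    (h : WellBehavedOn μ X Y g U) : ∀ᵐ ω ∂μ, (X ω, Y ω) ∈ U := by
  have h1 := h.full
  rw [Measure.map_apply (hX.prodMk hY) h.isOpen.measurableSet] at h1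
  exact (prob_compl_eq_zero_iff (hX.prodMk hY h.isOpen.measurableSet)).2 h1

/-- The coordinate change `(x, y) ↦ (x, g (x, y))` on `U`. -/
def sectionMap (g : ℝ × ℝ → ℝ) (z : ℝ × ℝ) : ℝ × ℝ := (z.1, g z)

theorem det_fst_prod (L : ℝ × ℝ →L[ℝ] ℝ) :
    ((ContinuousLinearMap.fst ℝ ℝ ℝ).prod L).det = L (0, 1) := by
  rw [ContinuousLinearMap.det, ← LinearMap.det_toMatrix (Module.Basis.finTwoProd ℝ),
    Matrix.det_fin_two]
  simp [LinearMap.toMatrix_apply]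

theorem partialY_eq_fderiv {g : ℝ × ℝ → ℝ} {z : ℝ × ℝ} (h : DifferentiableAt ℝ g z) :
    partialY g z = fderiv ℝ g z (0, 1) := by
  have h1 : HasDerivAt (fun s : ℝ => (z.1, s)) ((0 : ℝ), (1 : ℝ)) z.2 :=
    (hasDerivAt_const _ _).prodMk (hasDerivAt_id _)
  exact (HasFDerivAt.comp_hasDerivAt (f := fun s : ℝ => (z.1, s)) z.2 h.hasFDerivAt h1).deriv

theorem WellBehavedOn.injOn_sectionMap {μ : Measure Ω} {X Y : Ω → ℝ} {g : ℝ × ℝ → ℝ}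
    {U : Set (ℝ × ℝ)} (h : WellBehavedOn μ X Y g U) : Set.InjOn (sectionMap g) U := by
  rintro ⟨x, y⟩ hz ⟨x', y'⟩ hz' heq
  obtain ⟨rfl, h2⟩ := Prod.mk.inj heq
  exact Prod.ext rfl (h.injOn_snd x hz hz' h2)

/-- Change of variables along `(x, y) ↦ (x, g (x, y))`: the pair `(X, T)` has a Lebesgue density,
which at `(x, g (x, y))` is `p_{X,Y} (x, y) / |∂_y g (x, y)|`. -/
theorem exists_jointDensity {μ : Measure Ω} [IsProbabilityMeasure μ] {ρ : ℝ} {X Y T : Ω → ℝ}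
    {g : ℝ × ℝ → ℝ} {U : Set (ℝ × ℝ)} (hG : IsNormalizedGaussian μ ρ X Y T g)
    (hW : WellBehavedOn μ X Y g U) :
    ∃ q : ℝ × ℝ → ℝ≥0∞, Measurable q ∧
      μ.map (fun ω => (X ω, T ω)) = volume.withDensity q ∧
      ∀ z ∈ U, q (z.1, g z) = ENNReal.ofReal (bivariateDensity ρ z / |partialY g z|) := by
  have hUm := hW.isOpen.measurableSet
  have hmS : Measurable (sectionMap g) := measurable_fst.prodMk hG.continuous_kernel.measurable
  have hinj := hW.injOn_sectionMap
  have hdiff : ∀ z ∈ U, DifferentiableAt ℝ g z := fun z hz =>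
    (hW.contDiffOn.differentiableOn one_ne_zero).differentiableAt (hW.isOpen.mem_nhds hz)
  have hfd : ∀ z ∈ U, HasFDerivWithinAt (sectionMap g)
      ((ContinuousLinearMap.fst ℝ ℝ ℝ).prod (fderiv ℝ g z)) U z := fun z hz =>
    (hasFDerivAt_fst.prodMk (hdiff z hz).hasFDerivAt).hasFDerivWithinAt
  have := hUm.standardBorel
  have hemb : MeasurableEmbedding (fun z : U => sectionMap g z) :=
    (hmS.comp measurable_subtype_coe).measurableEmbedding fun a b hab =>
      Subtype.ext (hinj a.2 b.2 hab)
  have hpm := measurable_partialY hG.continuous_kernel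
  set d : ℝ × ℝ → ℝ≥0∞ := fun z => ENNReal.ofReal (bivariateDensity ρ z / |partialY g z|) with hd
  have hdm : Measurable d :=
    ((measurable_bivariateDensity ρ).div (by fun_prop)).ennreal_ofReal
  set q : ℝ × ℝ → ℝ≥0∞ :=
    Function.extend (fun z : U => sectionMap g z) (fun z : U => d z) 0 with hq
  have hqm : Measurable q :=
    hemb.measurable_extend (hdm.comp measurable_subtype_coe) measurable_const
  have hqU : ∀ z ∈ U, q (sectionMap g z) = d z := fun z hz =>
    hemb.injective.extend_apply (fun z : U => d z) 0 ⟨z, hz⟩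
  have hq0 : ∀ w ∉ sectionMap g '' U, q w = 0 := fun w hw =>
    Function.extend_apply' _ _ _ fun ⟨a, ha⟩ => hw ⟨a, a.2, ha⟩
  have himg : MeasurableSet (sectionMap g '' U) := by
    convert hemb.measurableSet_range using 1
    ext w
    simp
  refine ⟨q, hqm, ?_, hqU⟩
  ext S hS
  have hXY := hG.measurable_fst.prodMk hG.measurable_snd
  have hXT : (fun ω => (X ω, T ω)) = sectionMap g ∘ fun ω => (X ω, Y ω) :=
    funext fun ω => by simp [sectionMap, hG.target_eq]
  rw [hXT, ← Measure.map_map hmS hXY, Measure.map_apply hmS hS]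
  have hUae : ∀ᵐ z ∂(stdBivariateNormal ρ), z ∈ U := by
    rw [← hG.law]
    exact (ae_map_iff hXY.aemeasurable hUm).2 (hW.ae_mem hG.measurable_fst hG.measurable_snd)
  have e1 : stdBivariateNormal ρ (sectionMap g ⁻¹' S) =
      stdBivariateNormal ρ (sectionMap g ⁻¹' S ∩ U) := by
    refine measure_congr ?_
    filter_upwards [hUae] with z hz
    exact propext ⟨fun h => ⟨h, hz⟩, fun h => h.1⟩
  rw [hG.law, e1, stdBivariateNormal_eq, withDensity_apply _ ((hmS hS).inter hUm),
    withDensity_apply _ hS]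
  -- `q` vanishes off the image of `U`, so the integral may be taken over that image
  have e2 : ∫⁻ w in S, q w = ∫⁻ w in sectionMap g '' U, S.indicator q w := by
    rw [← lintegral_indicator hS, ← lintegral_indicator himg]
    refine lintegral_congr fun w => ?_
    by_cases hw : w ∈ sectionMap g '' U
    · rw [Set.indicator_of_mem hw]
    · rw [Set.indicator_of_notMem hw]
      exact Set.indicator_apply_eq_zero.2 fun _ => hq0 w hw
  rw [e2, lintegral_image_eq_lintegral_abs_det_fderiv_mul volume hUm hfd hinj,
    ← setLIntegral_indicator (hmS hS)]
  refine setLIntegral_congr_fun hUm fun z hz => ?_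
  have hpos := hW.partialY_pos z hz
  rw [det_fst_prod, ← partialY_eq_fderiv (hdiff z hz)]
  by_cases hzS : z ∈ sectionMap g ⁻¹' S
  · rw [Set.indicator_of_mem hzS, Set.indicator_of_mem (show sectionMap g z ∈ S from hzS),
      hqU z hz, hd, ← ENNReal.ofReal_mul hpos.le]
    congr 1
    field_simp
  · rw [Set.indicator_of_notMem hzS, Set.indicator_of_notMem (show sectionMap g z ∉ S from hzS),
      mul_zero]

theorem IsNormalizedGaussian.hasPDF_prod {μ : Measure Ω} [IsProbabilityMeasure μ] {ρ : ℝ}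
    {X Y T : Ω → ℝ} {g : ℝ × ℝ → ℝ} {U : Set (ℝ × ℝ)} (hG : IsNormalizedGaussian μ ρ X Y T g)
    (hW : WellBehavedOn μ X Y g U) : HasPDF (fun ω => (X ω, T ω)) μ volume := by
  obtain ⟨q, hq, hmap, -⟩ := exists_jointDensity hG hW
  exact hasPDF_of_map_eq_withDensity (hG.measurable_fst.prodMk hG.measurable_target).aemeasurable
    q hq.aemeasurable hmap

theorem ae_jointDens_eq {μ : Measure Ω} [IsProbabilityMeasure μ] {ρ : ℝ} (hρ : |ρ| < 1)
    {X Y T : Ω → ℝ} {g : ℝ × ℝ → ℝ} {U : Set (ℝ × ℝ)} (hG : IsNormalizedGaussian μ ρ X Y T g)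
    (hW : WellBehavedOn μ X Y g U) : ∀ᵐ ω ∂μ, jointDens μ X T (X ω) (T ω) =
      bivariateDensity ρ (X ω, Y ω) / |partialY g (X ω, Y ω)| := by
  have := hG.hasPDF_prod hW
  obtain ⟨q, hq, hmap, hqU⟩ := exists_jointDensity hG hW
  have hae := (pdf.eq_of_map_eq_withDensity (X := fun ω => (X ω, T ω)) q hq.aemeasurable).1 hmap
  have hae' := (HasPDF.quasiMeasurePreserving_of_measurable (fun ω => (X ω, T ω)) μ volume
    (hG.measurable_fst.prodMk hG.measurable_target)).ae hae
  filter_upwards [hae', hW.ae_mem hG.measurable_fst hG.measurable_snd] with ω h hU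
  have hb := bivariateDensity_pos hρ (X ω, Y ω)
  rw [jointDens, h, hG.target_eq, hqU _ hU, ENNReal.toReal_ofReal (by positivity)]

theorem ae_dens_eq {μ : Measure Ω} [IsProbabilityMeasure μ] {ρ : ℝ} (hρ : |ρ| < 1)
    {X Y T : Ω → ℝ} {g : ℝ × ℝ → ℝ} (hG : IsNormalizedGaussian μ ρ X Y T g) :
    ∀ᵐ ω ∂μ, dens μ X (X ω) = ProbabilityTheory.gaussianPDFReal 0 1 (X ω) := by
  have hm := ProbabilityTheory.measurable_gaussianPDF 0 1
  have hmap : μ.map X = volume.withDensity (ProbabilityTheory.gaussianPDF 0 1) := by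
    rw [← map_fst_stdBivariateNormal hρ, ← hG.law,
      Measure.map_map measurable_fst (hG.measurable_fst.prodMk hG.measurable_snd)]
    rfl
  have := hasPDF_of_map_eq_withDensity hG.measurable_fst.aemeasurable _ hm.aemeasurable hmap
  have hae := (pdf.eq_of_map_eq_withDensity (X := X) _ hm.aemeasurable).1 hmap
  filter_upwards [(HasPDF.quasiMeasurePreserving_of_measurable X μ volume
    hG.measurable_fst).ae hae] with ω h
  rw [dens, h, ProbabilityTheory.toReal_gaussianPDF]

theorem hasPDF_of_hasPDF_prod {μ : Measure Ω} [IsProbabilityMeasure μ] {X T : Ω → ℝ}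
    (hX : Measurable X) (hT : Measurable T) [h : HasPDF (fun ω => (X ω, T ω)) μ volume] :
    HasPDF T μ volume := by
  refine (hasPDF_iff_of_aemeasurable hT.aemeasurable).2 ⟨inferInstance, ?_⟩
  have h1 := (h.absolutelyContinuous.map measurable_snd).trans
    (Measure.quasiMeasurePreserving_snd (μ := (volume : Measure ℝ))
      (ν := (volume : Measure ℝ))).absolutelyContinuous
  rwa [Measure.map_map measurable_snd (hX.prodMk hT)] at h1

theorem ae_dens_pos {μ : Measure Ω} [IsProbabilityMeasure μ] {T : Ω → ℝ} (hT : Measurable T)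
    [h : HasPDF T μ volume] : ∀ᵐ ω ∂μ, 0 < dens μ T (T ω) := by
  have h1 : ∀ᵐ ω ∂μ, 0 < pdf T μ volume (T ω) :=
    ae_of_ae_map hT.aemeasurable (Measure.rnDeriv_pos h.absolutelyContinuous)
  have h2 : ∀ᵐ ω ∂μ, pdf T μ volume (T ω) < ∞ :=
    (HasPDF.quasiMeasurePreserving_of_measurable T μ volume hT).ae pdf.ae_lt_top
  filter_upwards [h1, h2] with ω h3 h4
  exact ENNReal.toReal_pos h3.ne' h4.ne

/-! ### Arithmetic in `[0, ∞]` -/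

/-- The positive and negative parts of `u`, `v` and `u - v` are balanced. -/
theorem _root_.ENNReal.ofReal_add_ofReal_neg_add_ofReal_neg_sub (u v : ℝ) :
    ENNReal.ofReal u + ENNReal.ofReal (-v) + ENNReal.ofReal (-(u - v)) =
      ENNReal.ofReal v + ENNReal.ofReal (-u) + ENNReal.ofReal (u - v) := by
  have h (a : ℝ) : ENNReal.ofReal a = ENNReal.ofReal (max a 0) := by
    rcases le_total a 0 with ha | ha
    · rw [max_eq_right ha, ENNReal.ofReal_of_nonpos ha, ENNReal.ofReal_zero]
    · rw [max_eq_left ha]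
  have hm (a : ℝ) : 0 ≤ max a 0 := le_max_right _ _
  simp only [h u, h (-v), h (-(u - v)), h v, h (-u), h (u - v)]
  rw [← ENNReal.ofReal_add (hm _) (hm _), ← ENNReal.ofReal_add (add_nonneg (hm _) (hm _)) (hm _),
    ← ENNReal.ofReal_add (hm _) (hm _), ← ENNReal.ofReal_add (add_nonneg (hm _) (hm _)) (hm _)]
  congr 1
  linarith [max_zero_sub_max_neg_zero_eq_self u, max_zero_sub_max_neg_zero_eq_self v,
    max_zero_sub_max_neg_zero_eq_self (u - v)]

/-- Upper bound for a truncated difference of truncated differences; no order between `a` and `b` or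
between `a'` and `b'` is required. -/
theorem _root_.ENNReal.tsub_min_le_of_add_le_add {a a' b b' w : ℝ≥0∞} (hb' : b' ≠ ∞)
    (h : a + b' ≤ a' + b + w) : a - b - min (a - b) (a' - b') ≤ w := by
  have h1 : a ≤ a' - b' + b + w := by
    refine (ENNReal.add_le_add_iff_right hb').1 (h.trans ?_)
    calc a' + b + w ≤ (a' - b' + b') + b + w := by gcongr; exact le_tsub_add
      _ = a' - b' + b + w + b' := by ring
  have h2 : a - b ≤ a' - b' + w := by
    rw [tsub_le_iff_right]
    exact h1.trans_eq (by ring)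
  rw [tsub_le_iff_right]
  rcases le_total (a - b) (a' - b') with h3 | h3
  · rw [min_eq_left h3]
    exact le_add_self
  · rw [min_eq_right h3]
    exact h2.trans_eq (add_comm _ _)

/-- Lower bound for the same expression, at the cost of the summand `b'` and of excluding `∞ - ∞`. -/
theorem _root_.ENNReal.le_tsub_min_add_of_add_eq_add {a a' b b' w w' : ℝ≥0∞} (hb : b ≠ ∞)
    (hb' : b' ≠ ∞) (hw' : w' ≠ ∞) (hmin : min (a - b) (a' - b') ≠ ∞)
    (h : a + b' + w' = a' + b + w) : w ≤ (a - b - min (a - b) (a' - b')) + b' + w' := by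
  -- if `a' = ∞`, the balance forces `a = ∞`, and the minimum would be infinite
  have hfin : a' - b' ≠ ∞ := by
    intro hI
    have ha' : a' = ∞ := by
      by_contra ha'
      exact ENNReal.sub_ne_top ha' hI
    have ha : a = ∞ := by
      by_contra ha
      rw [ha', top_add, top_add] at h
      exact ENNReal.add_ne_top.2 ⟨ENNReal.add_ne_top.2 ⟨ha, hb'⟩, hw'⟩ h
    rw [ha, ha', ENNReal.top_sub hb, ENNReal.top_sub hb', min_self] at hmin
    exact hmin rfl
  have h1 : a - b ≤ (a - b - min (a - b) (a' - b')) + (a' - b') :=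
    le_tsub_add.trans (add_le_add_right (min_le_right _ _) _)
  refine (ENNReal.add_le_add_iff_right (ENNReal.add_ne_top.2 ⟨hfin, hb⟩)).1 ?_
  calc w + (a' - b' + b) ≤ w + (a' + b) := by gcongr; exact tsub_le_self
    _ = a + b' + w' := by rw [h]; ring
    _ ≤ (a - b + b) + b' + w' := by gcongr; exact le_tsub_add
    _ ≤ ((a - b - min (a - b) (a' - b')) + (a' - b') + b) + b' + w' := by gcongr
    _ = _ := by ring

/-! ### Conditioning on the target -/

/-- Conditioning on `T` by integration against the conditional density `p_{X|T}`. -/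
theorem ae_lintegral_condDens_eq_condLExp {μ : Measure Ω} [IsProbabilityMeasure μ] {X T : Ω → ℝ}
    (hX : Measurable X) (hT : Measurable T) [HasPDF (fun ω => (X ω, T ω)) μ volume]
    {F : ℝ × ℝ → ℝ≥0∞} (hF : Measurable F) :
    (fun ω => ∫⁻ x, ENNReal.ofReal (condDens μ X T x (T ω)) * F (x, T ω)) =ᵐ[μ]
      μ⁻[fun ω => F (X ω, T ω)|MeasurableSpace.comap T inferInstance] := by
  have hTpdf : HasPDF T μ volume := hasPDF_of_hasPDF_prod hX hT
  have hj : Measurable (fun z : ℝ × ℝ => jointDens μ X T z.1 z.2) :=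
    (measurable_pdf _ μ volume).ennreal_toReal
  have hd : Measurable (dens μ T) := (measurable_pdf _ μ volume).ennreal_toReal
  have hc : Measurable (fun z : ℝ × ℝ => ENNReal.ofReal (condDens μ X T z.1 z.2)) :=
    (hj.div (hd.comp measurable_snd)).ennreal_ofReal
  have hcF : Measurable fun z : ℝ × ℝ => ENNReal.ofReal (condDens μ X T z.1 z.2) * F z := hc.mul hF
  have hA : Measurable fun t => ∫⁻ x, ENNReal.ofReal (condDens μ X T x t) * F (x, t) :=
    Measurable.lintegral_prod_left' (μ := (volume : Measure ℝ)) hcF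
  refine ae_eq_condLExp hT.comap_le μ _ (hA.comp (comap_measurable T)) ?_
  rintro _ ⟨S, hS, rfl⟩
  have hTp := ae_dens_pos (μ := μ) hT
  set S' : Set ℝ := S ∩ {t | 0 < dens μ T t} with hS'
  have hS'm : MeasurableSet S' := hS.inter (measurableSet_lt measurable_const hd)
  -- outcomes with vanishing `p_T` form a null set, so `S` may be replaced by `S'`
  have hae : T ⁻¹' S =ᵐ[μ] T ⁻¹' S' := by
    filter_upwards [hTp] with ω hω
    exact propext ⟨fun h => ⟨h, hω⟩, fun h => h.1⟩
  rw [setLIntegral_congr hae, setLIntegral_congr hae, ← lintegral_indicator (hT hS'm),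
    ← lintegral_indicator (hT hS'm)]
  have hG : Measurable (fun z : ℝ × ℝ => (Prod.snd ⁻¹' S').indicator F z) :=
    hF.indicator (measurable_snd hS'm)
  calc ∫⁻ ω, (T ⁻¹' S').indicator
        (fun ω => ∫⁻ x, ENNReal.ofReal (condDens μ X T x (T ω)) * F (x, T ω)) ω ∂μ
      = ∫⁻ t, pdf T μ volume t * S'.indicator
          (fun t => ∫⁻ x, ENNReal.ofReal (condDens μ X T x t) * F (x, t)) t :=
        (pdf.lintegral_pdf_mul (X := T) (hA.indicator hS'm).aemeasurable).symm
    _ = ∫⁻ t, ∫⁻ x, ENNReal.ofReal (jointDens μ X T x t) *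
          (Prod.snd ⁻¹' S').indicator F (x, t) := by
        refine lintegral_congr_ae ?_
        filter_upwards [pdf.ofReal_toReal_ae_eq (X := T) (ℙ := μ) (μ := volume)] with t ht
        by_cases h : t ∈ S'
        · have hpos : 0 < dens μ T t := h.2
          rw [Set.indicator_of_mem h, ← ht, ← lintegral_const_mul' _ _ ENNReal.ofReal_ne_top]
          refine lintegral_congr fun x => ?_
          rw [Set.indicator_of_mem (show (x, t) ∈ Prod.snd ⁻¹' S' from h), ← mul_assoc,
            ← ENNReal.ofReal_mul ENNReal.toReal_nonneg]
          congr 2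
          exact mul_div_cancel₀ _ hpos.ne'
        · rw [Set.indicator_of_notMem h, mul_zero]
          refine (lintegral_eq_zero_of_ae_eq_zero (Eventually.of_forall fun x => ?_)).symm
          simp only [Pi.zero_apply]
          rw [Set.indicator_of_notMem (show (x, t) ∉ Prod.snd ⁻¹' S' from h), mul_zero]
    _ = ∫⁻ z, ENNReal.ofReal (jointDens μ X T z.1 z.2) * (Prod.snd ⁻¹' S').indicator F z := by
        have hjG : Measurable fun z : ℝ × ℝ => ENNReal.ofReal (jointDens μ X T z.1 z.2) *
          (Prod.snd ⁻¹' S').indicator F z := hj.ennreal_ofReal.mul hG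
        rw [Measure.volume_eq_prod]
        exact (lintegral_prod_symm _ hjG.aemeasurable).symm
    _ = ∫⁻ z, pdf (fun ω => (X ω, T ω)) μ volume z * (Prod.snd ⁻¹' S').indicator F z := by
        refine lintegral_congr_ae ?_
        filter_upwards [pdf.ofReal_toReal_ae_eq (X := fun ω => (X ω, T ω)) (ℙ := μ)
          (μ := volume)] with z hz
        rw [← hz]
        rfl
    _ = _ := pdf.lintegral_pdf_mul (X := fun ω => (X ω, T ω)) hG.aemeasurable

/-! ### Comparison of the specific informations -/

theorem lintegral_dens_le_one {μ : Measure Ω} [IsProbabilityMeasure μ] {X : Ω → ℝ} :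
    ∫⁻ x, ENNReal.ofReal (dens μ X x) ≤ 1 :=
  calc ∫⁻ x, ENNReal.ofReal (dens μ X x) ≤ ∫⁻ x, pdf X μ volume x :=
        lintegral_mono fun _ => ENNReal.ofReal_toReal_le
    _ ≤ μ.map X Set.univ := by
        simpa using setLIntegral_pdf_le_map X μ volume Set.univ
    _ ≤ 1 := by
        by_cases hX : AEMeasurable X μ
        · rw [Measure.map_apply_of_aemeasurable hX .univ]
          exact prob_le_one
        · simp [Measure.map_of_not_aemeasurable hX]

/-- The negative part of the specific information is bounded, by `log u ≤ u` applied to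
`u = p_X p_T / p_{X,T}`. -/
theorem lintegral_condDens_mul_neg_pointwiseInfo_le {b : ℝ} (hb : 1 < b) {μ : Measure Ω}
    [IsProbabilityMeasure μ] {X T : Ω → ℝ} (t : ℝ) :
    ∫⁻ x, ENNReal.ofReal (condDens μ X T x t) * ENNReal.ofReal (-pointwiseInfo b μ X T x t) ≤
      ENNReal.ofReal (Real.log b)⁻¹ := by
  have hlog := Real.log_pos hb
  have hpt : ∀ x, ENNReal.ofReal (condDens μ X T x t) *
      ENNReal.ofReal (-pointwiseInfo b μ X T x t) ≤
        ENNReal.ofReal (Real.log b)⁻¹ * ENNReal.ofReal (dens μ X x) := by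
    intro x
    have hj : 0 ≤ jointDens μ X T x t := ENNReal.toReal_nonneg
    have hx : 0 ≤ dens μ X x := ENNReal.toReal_nonneg
    have ht : 0 ≤ dens μ T t := ENNReal.toReal_nonneg
    rw [condDens, pointwiseInfo, ← ENNReal.ofReal_mul (by positivity),
      ← ENNReal.ofReal_mul (by positivity), Real.logb, ← neg_div, ← Real.log_inv, inv_div]
    apply ENNReal.ofReal_le_ofReal
    have hle : Real.log (dens μ X x * dens μ T t / jointDens μ X T x t) ≤
        dens μ X x * dens μ T t / jointDens μ X T x t := Real.log_le_self (by positivity)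
    calc jointDens μ X T x t / dens μ T t *
          (Real.log (dens μ X x * dens μ T t / jointDens μ X T x t) / Real.log b)
        ≤ jointDens μ X T x t / dens μ T t *
          (dens μ X x * dens μ T t / jointDens μ X T x t / Real.log b) := by gcongr
      _ ≤ (Real.log b)⁻¹ * dens μ X x := by
        rcases hj.eq_or_lt with h | h
        · rw [← h]
          simp only [zero_div, zero_mul]
          positivity
        rcases ht.eq_or_lt with h' | h'
        · rw [← h']
          simp only [div_zero, zero_mul]
          positivity
        exact le_of_eq (by field_simp)
  calc _ ≤ ∫⁻ x, ENNReal.ofReal (Real.log b)⁻¹ * ENNReal.ofReal (dens μ X x) := lintegral_mono hpt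
    _ = ENNReal.ofReal (Real.log b)⁻¹ * ∫⁻ x, ENNReal.ofReal (dens μ X x) :=
        lintegral_const_mul' _ _ ENNReal.ofReal_ne_top
    _ ≤ _ := mul_le_of_le_one_right' lintegral_dens_le_one

theorem measurable_pointwiseInfo (b : ℝ) (μ : Measure Ω) (X T : Ω → ℝ) :
    Measurable fun z : ℝ × ℝ => pointwiseInfo b μ X T z.1 z.2 := by
  have h1 : Measurable (fun z : ℝ × ℝ => jointDens μ X T z.1 z.2) :=
    (measurable_pdf _ μ volume).ennreal_toReal
  have h2 : Measurable (dens μ T) := (measurable_pdf _ μ volume).ennreal_toReal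
  have h3 : Measurable (dens μ X) := (measurable_pdf _ μ volume).ennreal_toReal
  exact (Real.measurable_log.comp
    (h1.div ((h3.comp measurable_fst).mul (h2.comp measurable_snd)))).div_const _

/-- If `Z` is the difference of the pointwise informations of `X` and `Y` about `T`, then
conditioning `i_X⁺ + i_Y⁻ + Z⁻ = i_Y⁺ + i_X⁻ + Z⁺` on `T` relates the positive and negative parts of
the specific informations. Working with the parts avoids any integrability assumption. -/
theorem ae_specificInfo_balance {b : ℝ} {μ : Measure Ω} [IsProbabilityMeasure μ] {X Y T : Ω → ℝ}
    (hX : Measurable X) (hY : Measurable Y) (hT : Measurable T)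
    [HasPDF (fun ω => (X ω, T ω)) μ volume] [HasPDF (fun ω => (Y ω, T ω)) μ volume]
    {Z : Ω → ℝ}
    (hZ : ∀ᵐ ω ∂μ, pointwiseInfo b μ X T (X ω) (T ω) - pointwiseInfo b μ Y T (Y ω) (T ω) = Z ω) :
    ∀ᵐ ω ∂μ,
      (∫⁻ x, ENNReal.ofReal (condDens μ X T x (T ω)) *
          ENNReal.ofReal (pointwiseInfo b μ X T x (T ω))) +
        (∫⁻ x, ENNReal.ofReal (condDens μ Y T x (T ω)) *
          ENNReal.ofReal (-pointwiseInfo b μ Y T x (T ω))) +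
        (μ⁻[fun ω => ENNReal.ofReal (-Z ω)|MeasurableSpace.comap T inferInstance]) ω =
      (∫⁻ x, ENNReal.ofReal (condDens μ Y T x (T ω)) *
          ENNReal.ofReal (pointwiseInfo b μ Y T x (T ω))) +
        (∫⁻ x, ENNReal.ofReal (condDens μ X T x (T ω)) *
          ENNReal.ofReal (-pointwiseInfo b μ X T x (T ω))) +
        (μ⁻[fun ω => ENNReal.ofReal (Z ω)|MeasurableSpace.comap T inferInstance]) ω := by
  have mX := measurable_pointwiseInfo b μ X T
  have nX : Measurable fun z : ℝ × ℝ => -pointwiseInfo b μ X T z.1 z.2 := mX.neg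
  have mY := measurable_pointwiseInfo b μ Y T
  have nY : Measurable fun z : ℝ × ℝ => -pointwiseInfo b μ Y T z.1 z.2 := mY.neg
  have cX := hX.prodMk hT
  have cY := hY.prodMk hT
  have e1 := ae_lintegral_condDens_eq_condLExp (μ := μ) hX hT mX.ennreal_ofReal
  have e2 := ae_lintegral_condDens_eq_condLExp (μ := μ) hX hT nX.ennreal_ofReal
  have e3 := ae_lintegral_condDens_eq_condLExp (μ := μ) hY hT mY.ennreal_ofReal
  have e4 := ae_lintegral_condDens_eq_condLExp (μ := μ) hY hT nY.ennreal_ofReal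
  set iX : Ω → ℝ := fun ω => pointwiseInfo b μ X T (X ω) (T ω) with hiX
  set iY : Ω → ℝ := fun ω => pointwiseInfo b μ Y T (Y ω) (T ω) with hiY
  have miX : Measurable iX := mX.comp cX
  have miY : Measurable iY := mY.comp cY
  have hsum : (((fun ω => ENNReal.ofReal (iX ω)) + fun ω => ENNReal.ofReal (-iY ω)) +
      fun ω => ENNReal.ofReal (-Z ω)) =ᵐ[μ]
      ((fun ω => ENNReal.ofReal (iY ω)) + fun ω => ENNReal.ofReal (-iX ω)) +
        fun ω => ENNReal.ofReal (Z ω) := by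
    filter_upwards [hZ] with ω hω
    simp only [Pi.add_apply]
    rw [← hω]
    exact ENNReal.ofReal_add_ofReal_neg_add_ofReal_neg_sub _ _
  have hc := condLExp_congr_ae (mΩ := MeasurableSpace.comap T inferInstance) hsum
  have a1 := condLExp_add_left (P := μ) (mΩ := MeasurableSpace.comap T inferInstance)
    (X := (fun ω => ENNReal.ofReal (iX ω)) + fun ω => ENNReal.ofReal (-iY ω))
    (fun ω => ENNReal.ofReal (-Z ω)) (by fun_prop)
  have a2 := condLExp_add_left (P := μ) (mΩ := MeasurableSpace.comap T inferInstance)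
    (X := (fun ω => ENNReal.ofReal (iY ω)) + fun ω => ENNReal.ofReal (-iX ω))
    (fun ω => ENNReal.ofReal (Z ω)) (by fun_prop)
  have a3 := condLExp_add_left (P := μ) (mΩ := MeasurableSpace.comap T inferInstance) (X := fun ω => ENNReal.ofReal (iX ω))
    (fun ω => ENNReal.ofReal (-iY ω)) (by fun_prop)
  have a4 := condLExp_add_left (P := μ) (mΩ := MeasurableSpace.comap T inferInstance) (X := fun ω => ENNReal.ofReal (iY ω))
    (fun ω => ENNReal.ofReal (-iX ω)) (by fun_prop)
  filter_upwards [e1, e2, e3, e4, hc, a1, a2, a3, a4] with ω h1 h2 h3 h4 h5 h6 h7 h8 h9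
  simp only [Pi.add_apply] at h6 h7 h8 h9
  rw [h6, h7, h8, h9] at h5
  rw [h1, h2, h3, h4]
  exact h5

/-- `U_X^MIN ≤ E[(i_X - i_Y)⁺]`. -/
theorem uniqueMin_le_lintegral {b : ℝ} (hb : 1 < b) {μ : Measure Ω} [IsProbabilityMeasure μ]
    {X Y T : Ω → ℝ} (hX : Measurable X) (hY : Measurable Y) (hT : Measurable T)
    [HasPDF (fun ω => (X ω, T ω)) μ volume] [HasPDF (fun ω => (Y ω, T ω)) μ volume]
    {Z : Ω → ℝ}
    (hZ : ∀ᵐ ω ∂μ, pointwiseInfo b μ X T (X ω) (T ω) - pointwiseInfo b μ Y T (Y ω) (T ω) = Z ω) :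
    uniqueMin b μ X Y T ≤ ∫⁻ ω, ENNReal.ofReal (Z ω) ∂μ := by
  rw [← lintegral_condLExp hT.comap_le μ fun ω => ENNReal.ofReal (Z ω)]
  refine lintegral_mono_ae ?_
  filter_upwards [ae_specificInfo_balance hX hY hT hZ] with ω h
  refine ENNReal.tsub_min_le_of_add_le_add ?_ (le_self_add.trans_eq h)
  exact ((lintegral_condDens_mul_neg_pointwiseInfo_le hb _).trans_lt ENNReal.ofReal_lt_top).ne

/-- A lower bound matching `uniqueMin_le_lintegral` up to a constant and `E[(i_X - i_Y)⁻]`. -/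
theorem lintegral_le_uniqueMin_add {b : ℝ} (hb : 1 < b) {μ : Measure Ω} [IsProbabilityMeasure μ]
    {X Y T : Ω → ℝ} (hX : Measurable X) (hY : Measurable Y) (hT : Measurable T)
    [HasPDF (fun ω => (X ω, T ω)) μ volume] [HasPDF (fun ω => (Y ω, T ω)) μ volume]
    (hdet : ∀ᵐ ω ∂μ, min (specificInfo b μ X T (T ω)) (specificInfo b μ Y T (T ω)) ≠ ∞)
    {Z : Ω → ℝ}
    (hZ : ∀ᵐ ω ∂μ, pointwiseInfo b μ X T (X ω) (T ω) - pointwiseInfo b μ Y T (Y ω) (T ω) = Z ω)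
    (hfin : ∫⁻ ω, ENNReal.ofReal (-Z ω) ∂μ ≠ ∞) :
    ∫⁻ ω, ENNReal.ofReal (Z ω) ∂μ ≤ uniqueMin b μ X Y T + ENNReal.ofReal (Real.log b)⁻¹ +
      ∫⁻ ω, ENNReal.ofReal (-Z ω) ∂μ := by
  have hU : Measurable fun ω => specificInfo b μ X T (T ω) -
      min (specificInfo b μ X T (T ω)) (specificInfo b μ Y T (T ω)) := by
    have h1 := (measurable_specificInfo b μ X T).comp hT
    have h2 := (measurable_specificInfo b μ Y T).comp hT
    exact h1.sub (h1.min h2)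
  have hconst : ENNReal.ofReal (Real.log b)⁻¹ = ∫⁻ _, ENNReal.ofReal (Real.log b)⁻¹ ∂μ := by simp
  rw [hconst, uniqueMin, ← lintegral_add_left hU,
    ← lintegral_condLExp hT.comap_le μ fun ω => ENNReal.ofReal (Z ω),
    ← lintegral_condLExp hT.comap_le μ fun ω => ENNReal.ofReal (-Z ω),
    ← lintegral_add_left (hU.add_const _)]
  refine lintegral_mono_ae ?_
  filter_upwards [ae_specificInfo_balance hX hY hT hZ, hdet,
    condLExp_ne_top (mΩ := MeasurableSpace.comap T inferInstance) hfin] with ω h hd hw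
  have hbX := lintegral_condDens_mul_neg_pointwiseInfo_le hb (μ := μ) (X := X) (T := T) (T ω)
  have hbY := lintegral_condDens_mul_neg_pointwiseInfo_le hb (μ := μ) (X := Y) (T := T) (T ω)
  refine (ENNReal.le_tsub_min_add_of_add_eq_add (hbX.trans_lt ENNReal.ofReal_lt_top).ne
    (hbY.trans_lt ENNReal.ofReal_lt_top).ne hw hd h).trans ?_
  simp only [specificInfo]
  gcongr

/-! ### Differences of pointwise quantities -/

/-- The log-ratio of the partials, `log (|∂ₓ g| / |∂_y g|)` at `(X, Y)`. -/
def logRatio (b : ℝ) (X Y : Ω → ℝ) (g : ℝ × ℝ → ℝ) (ω : Ω) : ℝ :=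
  Real.logb b (|partialX g (X ω, Y ω)| / |partialY g (X ω, Y ω)|)

/-- `(X² - Y²) / 2 · log e`, the log-ratio `log (p_Y (Y) / p_X (X))` of the standard normal
marginals. -/
def marginalGap (b : ℝ) (X Y : Ω → ℝ) (ω : Ω) : ℝ :=
  (X ω ^ 2 - Y ω ^ 2) * (2 * Real.log b)⁻¹

theorem measurable_logRatio (b : ℝ) {X Y : Ω → ℝ} (hX : Measurable X) (hY : Measurable Y)
    {g : ℝ × ℝ → ℝ} (hg : Continuous g) : Measurable (logRatio b X Y g) := by
  have h1 := (measurable_partialX hg).comp (hX.prodMk hY)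
  have h2 := (measurable_partialY hg).comp (hX.prodMk hY)
  exact (Real.measurable_log.comp (h1.abs.div h2.abs)).div_const _

theorem measurable_marginalGap (b : ℝ) {X Y : Ω → ℝ} (hX : Measurable X) (hY : Measurable Y) :
    Measurable (marginalGap b X Y) :=
  ((hX.pow_const 2).sub (hY.pow_const 2)).mul_const _

theorem log_gaussianPDFReal_std (x : ℝ) : Real.log (ProbabilityTheory.gaussianPDFReal 0 1 x) =
    Real.log (ProbabilityTheory.gaussianPDFReal 0 1 0) - x ^ 2 / 2 := by
  have hpi := Real.pi_pos
  have h : (Real.sqrt (2 * Real.pi * ((1 : NNReal) : ℝ)))⁻¹ ≠ 0 := by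
    rw [NNReal.coe_one]
    positivity
  rw [ProbabilityTheory.gaussianPDFReal, ProbabilityTheory.gaussianPDFReal,
    Real.log_mul h (Real.exp_pos _).ne', Real.log_mul h (Real.exp_pos _).ne', Real.log_exp,
    Real.log_exp, NNReal.coe_one]
  ring

theorem ae_specificity_sub {b : ℝ} {μ : Measure Ω} [IsProbabilityMeasure μ] {ρ : ℝ}
    (hρ : |ρ| < 1) {X Y T : Ω → ℝ} {g : ℝ × ℝ → ℝ} (hG : IsNormalizedGaussian μ ρ X Y T g) :
    ∀ᵐ ω ∂μ, specificity b μ X ω - specificity b μ Y ω = marginalGap b X Y ω := by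
  filter_upwards [ae_dens_eq hρ hG, ae_dens_eq hρ hG.swap] with ω hX hY
  rw [specificity, specificity, hX, hY, Real.logb, Real.logb, one_div, one_div, Real.log_inv,
    Real.log_inv, log_gaussianPDFReal_std (X ω), log_gaussianPDFReal_std (Y ω), marginalGap]
  rw [mul_inv]
  ring

/-- The joint densities of `(X, T)` and `(Y, T)` share the numerator `p_{X,Y}`, so that their ratio is
that of the Jacobians. -/
theorem ae_log_jointDens_sub {μ : Measure Ω} [IsProbabilityMeasure μ] {ρ : ℝ} (hρ : |ρ| < 1)
    {X Y T : Ω → ℝ} {g : ℝ × ℝ → ℝ} {U : Set (ℝ × ℝ)} (hG : IsNormalizedGaussian μ ρ X Y T g)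
    (hW : WellBehavedOn μ X Y g U) :
    ∀ᵐ ω ∂μ, 0 < jointDens μ X T (X ω) (T ω) ∧ 0 < jointDens μ Y T (Y ω) (T ω) ∧
      Real.log (jointDens μ X T (X ω) (T ω)) - Real.log (jointDens μ Y T (Y ω) (T ω)) =
        Real.log (|partialX g (X ω, Y ω)| / |partialY g (X ω, Y ω)|) := by
  have hX := hG.measurable_fst
  have hY := hG.measurable_snd
  filter_upwards [ae_jointDens_eq hρ hG hW, ae_jointDens_eq hρ hG.swap (hW.swap hX hY),
    hW.ae_mem hX hY] with ω h1 h2 hU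
  have hb := bivariateDensity_pos hρ (X ω, Y ω)
  have hpx := hW.partialX_pos _ hU
  have hpy := hW.partialY_pos _ hU
  rw [show bivariateDensity ρ (Y ω, X ω) = bivariateDensity ρ (X ω, Y ω) from
    bivariateDensity_swap ρ (X ω, Y ω), show partialY (g ∘ Prod.swap) (Y ω, X ω) =
      partialX g (X ω, Y ω) from rfl] at h2
  rw [h1, h2, Real.log_div hb.ne' hpy.ne', Real.log_div hb.ne' hpx.ne',
    Real.log_div hpx.ne' hpy.ne']
  exact ⟨by positivity, by positivity, by ring⟩

theorem ae_ambiguity_sub {b : ℝ} {μ : Measure Ω} [IsProbabilityMeasure μ] {ρ : ℝ} (hρ : |ρ| < 1)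
    {X Y T : Ω → ℝ} {g : ℝ × ℝ → ℝ} {U : Set (ℝ × ℝ)} (hG : IsNormalizedGaussian μ ρ X Y T g)
    (hW : WellBehavedOn μ X Y g U) :
    ∀ᵐ ω ∂μ, ambiguity b μ X T ω - ambiguity b μ Y T ω = -logRatio b X Y g ω := by
  have := hG.hasPDF_prod hW
  have := hasPDF_of_hasPDF_prod (μ := μ) hG.measurable_fst hG.measurable_target
  filter_upwards [ae_log_jointDens_sub hρ hG hW, ae_dens_pos (μ := μ) hG.measurable_target]
    with ω h hT
  obtain ⟨hX, hY, h⟩ := h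
  rw [ambiguity, ambiguity, condDens, condDens, logRatio, Real.logb, Real.logb, Real.logb, ← h,
    one_div, one_div, Real.log_inv, Real.log_inv, Real.log_div hX.ne' hT.ne',
    Real.log_div hY.ne' hT.ne']
  ring

theorem ae_pointwiseInfo_sub {b : ℝ} {μ : Measure Ω} [IsProbabilityMeasure μ] {ρ : ℝ}
    (hρ : |ρ| < 1) {X Y T : Ω → ℝ} {g : ℝ × ℝ → ℝ} {U : Set (ℝ × ℝ)}
    (hG : IsNormalizedGaussian μ ρ X Y T g) (hW : WellBehavedOn μ X Y g U) :
    ∀ᵐ ω ∂μ, pointwiseInfo b μ X T (X ω) (T ω) - pointwiseInfo b μ Y T (Y ω) (T ω) =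
      logRatio b X Y g ω + marginalGap b X Y ω := by
  have := hG.hasPDF_prod hW
  have := hasPDF_of_hasPDF_prod (μ := μ) hG.measurable_fst hG.measurable_target
  filter_upwards [ae_log_jointDens_sub hρ hG hW, ae_dens_pos (μ := μ) hG.measurable_target,
    ae_dens_eq hρ hG, ae_dens_eq hρ hG.swap] with ω h hT hdX hdY
  obtain ⟨hX, hY, h⟩ := h
  have hpX := ProbabilityTheory.gaussianPDFReal_pos 0 1 (X ω) one_ne_zero
  have hpY := ProbabilityTheory.gaussianPDFReal_pos 0 1 (Y ω) one_ne_zero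
  rw [pointwiseInfo, pointwiseInfo, logRatio, marginalGap, Real.logb, Real.logb, Real.logb, ← h,
    hdX, hdY, Real.log_div hX.ne' (mul_pos hpX hT).ne', Real.log_div hY.ne' (mul_pos hpY hT).ne',
    Real.log_mul hpX.ne' hT.ne', Real.log_mul hpY.ne' hT.ne', log_gaussianPDFReal_std (X ω),
    log_gaussianPDFReal_std (Y ω), mul_inv]
  ring

/-! ### Unique specificity and ambiguity -/

theorem ofReal_sub_min (u v : ℝ) : ENNReal.ofReal (u - min u v) = ENNReal.ofReal (u - v) := by
  rcases le_total u v with h | h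
  · rw [min_eq_left h, sub_self, ENNReal.ofReal_zero, ENNReal.ofReal_of_nonpos (by linarith)]
  · rw [min_eq_right h]

theorem uniquePMAmbiguity_eq {b : ℝ} {μ : Measure Ω} {X Y T L : Ω → ℝ}
    (h : ∀ᵐ ω ∂μ, ambiguity b μ X T ω - ambiguity b μ Y T ω = L ω) :
    uniquePMAmbiguity b μ X Y T = ∫⁻ ω, ENNReal.ofReal (L ω) ∂μ := by
  refine lintegral_congr_ae ?_
  filter_upwards [h] with ω hω
  rw [ofReal_sub_min, hω]

theorem lintegral_marginalGap {b : ℝ} (hb : 1 < b) {μ : Measure Ω} {ρ : ℝ} (hρ : |ρ| < 1)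
    {X Y T : Ω → ℝ} {g : ℝ × ℝ → ℝ} (hG : IsNormalizedGaussian μ ρ X Y T g) :
    ∫⁻ ω, ENNReal.ofReal (marginalGap b X Y ω) ∂μ =
      ENNReal.ofReal (Real.logb b (Real.exp 1) / Real.pi * Real.sqrt (1 - ρ ^ 2)) := by
  have hlog := Real.log_pos hb
  have hpi := Real.pi_pos
  have hs := Real.sqrt_nonneg (1 - ρ ^ 2)
  have hm : Measurable fun z : ℝ × ℝ => ENNReal.ofReal (z.1 ^ 2 - z.2 ^ 2) := by fun_prop
  have h1 : ∀ ω, ENNReal.ofReal (marginalGap b X Y ω) =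
      ENNReal.ofReal (X ω ^ 2 - Y ω ^ 2) * ENNReal.ofReal (2 * Real.log b)⁻¹ := fun ω =>
    ENNReal.ofReal_mul' (by positivity)
  rw [lintegral_congr h1, lintegral_mul_const' _ _ ENNReal.ofReal_ne_top,
    ← lintegral_map (f := fun z : ℝ × ℝ => ENNReal.ofReal (z.1 ^ 2 - z.2 ^ 2)) hm
      (hG.measurable_fst.prodMk hG.measurable_snd), hG.law, lintegral_sq_sub_sq hρ,
    ← ENNReal.ofReal_mul (by positivity), Real.logb, Real.log_exp]
  congr 1
  field_simp

theorem uniquePMSpecificity_eq {b : ℝ} (hb : 1 < b) {μ : Measure Ω} [IsProbabilityMeasure μ]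
    {ρ : ℝ} (hρ : |ρ| < 1) {X Y T : Ω → ℝ} {g : ℝ × ℝ → ℝ}
    (hG : IsNormalizedGaussian μ ρ X Y T g) : uniquePMSpecificity b μ X Y =
      ENNReal.ofReal (Real.logb b (Real.exp 1) / Real.pi * Real.sqrt (1 - ρ ^ 2)) := by
  rw [← lintegral_marginalGap hb hρ hG]
  refine lintegral_congr_ae ?_
  filter_upwards [ae_specificity_sub hρ hG] with ω hω
  rw [ofReal_sub_min, hω]

/-! ### Limits -/

/-- Dominated convergence for the positive parts of a decreasing sequence tending to `-∞`. -/
theorem tendsto_lintegral_ofReal_of_antitone {μ : Measure Ω} {L : ℕ → Ω → ℝ}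
    (hm : ∀ n, Measurable (L n)) (hanti : ∀ᵐ ω ∂μ, Antitone fun n => L n ω)
    (hlim : ∀ᵐ ω ∂μ, Tendsto (fun n => L n ω) atTop atBot)
    (h0 : ∫⁻ ω, ENNReal.ofReal (L 0 ω) ∂μ ≠ ∞) :
    Tendsto (fun n => ∫⁻ ω, ENNReal.ofReal (L n ω) ∂μ) atTop (𝓝 0) := by
  rw [← lintegral_zero (μ := μ)]
  refine tendsto_lintegral_of_dominated_convergence (fun ω => ENNReal.ofReal (L 0 ω))
    (fun n => (hm n).ennreal_ofReal) (fun n => ?_) h0 ?_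
  · filter_upwards [hanti] with ω h
    exact ENNReal.ofReal_le_ofReal (h n.zero_le)
  · filter_upwards [hlim] with ω h
    refine tendsto_const_nhds.congr' ?_
    filter_upwards [h.eventually_le_atBot 0] with n hn
    exact (ENNReal.ofReal_of_nonpos hn).symm

/-- Monotone convergence for the negative parts of a decreasing sequence tending to `-∞`. -/
theorem tendsto_lintegral_ofReal_neg_of_antitone {μ : Measure Ω} [IsProbabilityMeasure μ]
    {L : ℕ → Ω → ℝ} (hm : ∀ n, Measurable (L n)) (hanti : ∀ᵐ ω ∂μ, Antitone fun n => L n ω)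
    (hlim : ∀ᵐ ω ∂μ, Tendsto (fun n => L n ω) atTop atBot) :
    Tendsto (fun n => ∫⁻ ω, ENNReal.ofReal (-L n ω) ∂μ) atTop (𝓝 ∞) := by
  have htop : ∫⁻ _, (∞ : ℝ≥0∞) ∂μ = ∞ := by simp
  rw [← htop]
  refine lintegral_tendsto_of_tendsto_of_monotone
    (fun n => (hm n).neg.ennreal_ofReal.aemeasurable) ?_ ?_
  · filter_upwards [hanti] with ω h i j hij
    exact ENNReal.ofReal_le_ofReal (neg_le_neg (h hij))
  · filter_upwards [hlim] with ω h
    exact ENNReal.tendsto_ofReal_atTop.comp (tendsto_neg_atBot_atTop.comp h)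

theorem ae_logRatio_antitone_tendsto {b : ℝ} (hb : 1 < b) {μ : Measure Ω}
    [IsProbabilityMeasure μ] {X Y : Ω → ℝ} (hX : Measurable X) (hY : Measurable Y)
    {g : ℕ → ℝ × ℝ → ℝ} {U : Set (ℝ × ℝ)} (hW : ∀ n, WellBehavedOn μ X Y (g n) U)
    (hratio : ∀ᵐ ω ∂μ,
      Antitone (fun n => |partialX (g n) (X ω, Y ω)| / |partialY (g n) (X ω, Y ω)|) ∧
      Tendsto (fun n => |partialX (g n) (X ω, Y ω)| / |partialY (g n) (X ω, Y ω)|)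
        atTop (𝓝 0)) :
    ∀ᵐ ω ∂μ, Antitone (fun n => logRatio b X Y (g n) ω) ∧
      Tendsto (fun n => logRatio b X Y (g n) ω) atTop atBot := by
  filter_upwards [hratio, (hW 0).ae_mem hX hY] with ω h hU
  have hpos : ∀ n, 0 < |partialX (g n) (X ω, Y ω)| / |partialY (g n) (X ω, Y ω)| := fun n =>
    div_pos ((hW n).partialX_pos _ hU) ((hW n).partialY_pos _ hU)
  refine ⟨fun i j hij => Real.logb_le_logb_of_le hb (hpos j) (h.1 hij), ?_⟩
  exact (Real.tendsto_log_nhdsGT_zero.comp (tendsto_nhdsWithin_iff.2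
    ⟨h.2, Eventually.of_forall hpos⟩)).atBot_div_const (Real.log_pos hb)

end NFBI

end

theorem mainTheorem2 {Ω : Type*} [MeasurableSpace Ω] (μ : Measure Ω) [IsProbabilityMeasure μ]
    (b : ℝ) (hb : 1 < b) (ρ : ℝ) (hρ : |ρ| < 1)
    (X Y : Ω → ℝ) (T : ℕ → Ω → ℝ) (g : ℕ → ℝ × ℝ → ℝ) (U : Set (ℝ × ℝ))
    (hgauss : ∀ n, NFBI.IsNormalizedGaussian μ ρ X Y (T n) (g n))
    (hwell : ∀ n, NFBI.WellBehavedOn μ X Y (g n) U)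
    -- the differences `I_X(T) - I_Y(T)` defining the MIN atoms are not of the form `∞ - ∞`
    (hdet : ∀ n, ∀ᵐ ω ∂μ, min (NFBI.specificInfo b μ X (T n) (T n ω))
      (NFBI.specificInfo b μ Y (T n) (T n ω)) ≠ ⊤)
    -- finite unique informations for the first interaction
    (hXmin : NFBI.uniqueMin b μ X Y (T 0) ≠ ⊤)
    (hYmin : NFBI.uniqueMin b μ Y X (T 0) ≠ ⊤)
    (hXpm : NFBI.uniquePM b μ X Y (T 0) ≠ ⊤ ∧ NFBI.uniquePM b μ X Y (T 0) ≠ ⊥)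
    (hYpm : NFBI.uniquePM b μ Y X (T 0) ≠ ⊤ ∧ NFBI.uniquePM b μ Y X (T 0) ≠ ⊥)
    -- the ratio of the partials decreases to `0` almost surely
    (hratio : ∀ᵐ ω ∂μ,
      Antitone (fun n => |NFBI.partialX (g n) (X ω, Y ω)| / |NFBI.partialY (g n) (X ω, Y ω)|) ∧
      Tendsto (fun n => |NFBI.partialX (g n) (X ω, Y ω)| / |NFBI.partialY (g n) (X ω, Y ω)|)
        atTop (𝓝 0)) :
    Tendsto (fun n => NFBI.uniqueMin b μ X Y (T n)) atTop (𝓝 0) ∧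
    Tendsto (fun n => NFBI.uniquePM b μ X Y (T n)) atTop (𝓝 ⊥) ∧
    Tendsto (fun n => NFBI.uniquePMAmbiguity b μ X Y (T n)) atTop (𝓝 ⊤) ∧
    Tendsto (fun n => NFBI.uniqueMin b μ Y X (T n)) atTop (𝓝 ⊤) ∧
    Tendsto (fun n => NFBI.uniquePM b μ Y X (T n)) atTop
      (𝓝 ((Real.logb b (Real.exp 1) / Real.pi * Real.sqrt (1 - ρ ^ 2) : ℝ) : EReal)) ∧
    Tendsto (fun n => NFBI.uniquePMAmbiguity b μ Y X (T n)) atTop (𝓝 0) := by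
  have hX := (hgauss 0).measurable_fst
  have hY := (hgauss 0).measurable_snd
  have hT n := (hgauss n).measurable_target
  have hpX n : HasPDF (fun ω => (X ω, T n ω)) μ volume := (hgauss n).hasPDF_prod (hwell n)
  have hpY n : HasPDF (fun ω => (Y ω, T n ω)) μ volume :=
    (hgauss n).swap.hasPDF_prod ((hwell n).swap hX hY)
  set c : ℝ := Real.logb b (Real.exp 1) / Real.pi * Real.sqrt (1 - ρ ^ 2) with hc
  have hc0 : 0 ≤ c := by
    have := Real.pi_pos
    have : 0 ≤ Real.logb b (Real.exp 1) := Real.logb_nonneg hb (Real.one_le_exp zero_le_one)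
    positivity
  set D : Ω → ℝ := NFBI.marginalGap b X Y with hD
  set L : ℕ → Ω → ℝ := fun n => NFBI.logRatio b X Y (g n) with hL
  have hDm : Measurable D := NFBI.measurable_marginalGap b hX hY
  have hLm n : Measurable (L n) := NFBI.measurable_logRatio b hX hY (hgauss n).continuous_kernel
  have hLlim := NFBI.ae_logRatio_antitone_tendsto hb hX hY hwell hratio
  have hanti : ∀ᵐ ω ∂μ, Antitone fun n => L n ω := hLlim.mono fun _ h => h.1
  have hlim : ∀ᵐ ω ∂μ, Tendsto (fun n => L n ω) atTop atBot := hLlim.mono fun _ h => h.2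
  have hantiZ : ∀ᵐ ω ∂μ, Antitone fun n => L n ω + D ω :=
    hanti.mono fun ω h i j hij => add_le_add_left (h hij) (D ω)
  have hlimZ : ∀ᵐ ω ∂μ, Tendsto (fun n => L n ω + D ω) atTop atBot :=
    hlim.mono fun ω h => tendsto_atBot_add_const_right _ (D ω) h
  have hZm n : Measurable fun ω => L n ω + D ω := (hLm n).add hDm
  -- the ambiguity gap is `-L n`, the specificity gap is `D`
  have hambX n : NFBI.uniquePMAmbiguity b μ X Y (T n) = ∫⁻ ω, ENNReal.ofReal (-L n ω) ∂μ :=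
    NFBI.uniquePMAmbiguity_eq (NFBI.ae_ambiguity_sub hρ (hgauss n) (hwell n))
  have hambY n : NFBI.uniquePMAmbiguity b μ Y X (T n) = ∫⁻ ω, ENNReal.ofReal (L n ω) ∂μ :=
    NFBI.uniquePMAmbiguity_eq <|
      (NFBI.ae_ambiguity_sub (b := b) hρ (hgauss n) (hwell n)).mono fun ω h => by
        rw [← neg_sub, h, neg_neg]
  have hspX : NFBI.uniquePMSpecificity b μ X Y = ENNReal.ofReal c :=
    NFBI.uniquePMSpecificity_eq hb hρ (hgauss 0)
  have hspY : NFBI.uniquePMSpecificity b μ Y X = ENNReal.ofReal c :=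
    NFBI.uniquePMSpecificity_eq hb hρ (hgauss 0).swap
  have hcE : ((ENNReal.ofReal c : ℝ≥0∞) : EReal) = (c : EReal) := by
    rw [EReal.coe_ennreal_ofReal, max_eq_left hc0]
  -- `U_Y^PM` of the first interaction is not `-∞`, so its ambiguity part is finite
  have hL0 : ∫⁻ ω, ENNReal.ofReal (L 0 ω) ∂μ ≠ ∞ := by
    intro h
    apply hYpm.2
    rw [NFBI.uniquePM, hambY 0, h, EReal.coe_ennreal_top, EReal.sub_top]
  have hZ0 : ∫⁻ ω, ENNReal.ofReal (L 0 ω + D ω) ∂μ ≠ ∞ := by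
    refine ((lintegral_mono fun ω => ENNReal.ofReal_add_le).trans_lt ?_).ne
    rw [lintegral_add_left (hLm 0).ennreal_ofReal, hD,
      NFBI.lintegral_marginalGap hb hρ (hgauss 0)]
    exact ENNReal.add_lt_top.2 ⟨hL0.lt_top, ENNReal.ofReal_lt_top⟩
  have hLpos := NFBI.tendsto_lintegral_ofReal_of_antitone hLm hanti hlim hL0
  have hLneg := NFBI.tendsto_lintegral_ofReal_neg_of_antitone hLm hanti hlim
  have hZpos := NFBI.tendsto_lintegral_ofReal_of_antitone hZm hantiZ hlimZ hZ0
  have hZneg := NFBI.tendsto_lintegral_ofReal_neg_of_antitone hZm hantiZ hlimZ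
  have hinfo n := NFBI.ae_pointwiseInfo_sub (b := b) hρ (hgauss n) (hwell n)
  have hdiff {a : ℕ → ℝ≥0∞} {l : ℝ≥0∞} (ha : Tendsto a atTop (𝓝 l)) :
      Tendsto (fun n => (c : EReal) - (a n : EReal)) atTop (𝓝 ((c : EReal) - (l : EReal))) := by
    have h1 : Tendsto (fun n => -(a n : EReal)) atTop (𝓝 (-(l : EReal))) :=
      ((continuous_neg.comp continuous_coe_ennreal_ereal).tendsto l).comp ha
    exact (EReal.continuousAt_add (p := ((c : EReal), -(l : EReal))) (Or.inl (EReal.coe_ne_top c))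
      (Or.inl (EReal.coe_ne_bot c))).tendsto.comp (tendsto_const_nhds.prodMk_nhds h1)
  refine ⟨?_, ?_, ?_, ?_, ?_, ?_⟩
  · exact tendsto_of_tendsto_of_tendsto_of_le_of_le tendsto_const_nhds hZpos (fun _ => zero_le)
      fun n => NFBI.uniqueMin_le_lintegral hb hX hY (hT n) (hinfo n)
  · have h := hdiff hLneg
    rw [EReal.coe_ennreal_top, EReal.sub_top] at h
    simpa only [NFBI.uniquePM, hspX, hcE, hambX] using h
  · simpa only [hambX] using hLneg
  · -- once `E[(L n + D)⁺] < 1`, the atom is at least `E[(L n + D)⁻]` up to a fixed constant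
    have hbound : ∀ᶠ n in atTop, ∫⁻ ω, ENNReal.ofReal (-(L n ω + D ω)) ∂μ ≤
        NFBI.uniqueMin b μ Y X (T n) + (ENNReal.ofReal (Real.log b)⁻¹ + 1) := by
      filter_upwards [hZpos.eventually_lt_const zero_lt_one] with n hn
      have hfin : ∫⁻ ω, ENNReal.ofReal (- -(L n ω + D ω)) ∂μ < 1 := by simpa only [neg_neg] using hn
      refine (NFBI.lintegral_le_uniqueMin_add hb hY hX (hT n) ?_
        (Z := fun ω => -(L n ω + D ω)) ?_ (hfin.trans ENNReal.one_lt_top).ne).trans ?_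
      · simpa only [min_comm] using hdet n
      · filter_upwards [hinfo n] with ω h
        rw [← neg_sub, h]
      · rw [← add_assoc]
        exact add_le_add_right hfin.le _
    have hK : ENNReal.ofReal (Real.log b)⁻¹ + 1 ≠ ∞ :=
      ENNReal.add_ne_top.2 ⟨ENNReal.ofReal_ne_top, ENNReal.one_ne_top⟩
    have hsub := ENNReal.Tendsto.sub hZneg
      (tendsto_const_nhds (x := ENNReal.ofReal (Real.log b)⁻¹ + 1)) (Or.inr hK)
    rw [ENNReal.top_sub hK] at hsub
    exact tendsto_of_tendsto_of_tendsto_of_le_of_le' hsub tendsto_const_nhds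
      (hbound.mono fun n h => tsub_le_iff_right.2 h) (Eventually.of_forall fun _ => le_top)
  · have h := hdiff hLpos
    rw [EReal.coe_ennreal_zero, sub_zero] at h
    simpa only [NFBI.uniquePM, hspY, hcE, hambY] using h
  · simpa only [hambY] using hLpos
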